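/- Let $\mathbb{D}$ be the open unit disc of $\mathbb{C}$, let $dm$ be Lebesgue area measure, and for $0<p<\infty$ let $H^p$ be the Hardy space of analytic functions $h$ in $\mathbb{D}$ with $$\|h\|_{H^p}=\lim_{r\to1^-}\Bigl(\frac1{2\pi}\int_0^{2\pi}|h(re^{i\theta})|^p\,d\theta\Bigr)^{1/p}<\infty .$$ A positive Borel measure $\mu$ on $\mathbb{D}$ is a Carleson measure if there is a constant $C>0$ such that $\int_{\mathbb{D}}|h|^p\,d\mu\le C\,\|h\|_{H^p}^p$ for all $h\in H^p$ (where $0<p<\infty$ is any fixed exponent; the notion does not depend on $p$). Theorem. Let $A$ be analytic in $\mathbb{D}$ and suppose that $|A(z)|(1-|z|^2)\,dm(z)$ is a Carleson measure. Then the zero-sequence $\{z_n\}$ (finite or infinite, zeros listed according to multiplicity) of every non-trivial solution $f\not\equiv0$ of $$f''+Af=0\quad\text{in }\mathbb{D}$$ is uniformly separated, that is, $$\inf_{k}\ \prod_{n\ne k}\left|\frac{z_n-z_k}{1-\overline{z}_n z_k}\right|>0 .$$ -/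

import Mathlib

open MeasureTheory Filter Topology
open scoped ENNReal NNReal ComplexConjugate

noncomputable section

namespace DiskODE

/-- The open unit disc `𝔻` of the complex plane. -/
abbrev disc : Set ℂ := Metric.ball (0 : ℂ) 1

/-- The integral mean `(1/2π) ∫₀^{2π} |f(r e^{iθ})|^p dθ`, with values in `[0,∞]`. -/
def circleMean (p : ℝ) (f : ℂ → ℂ) (r : ℝ) : ℝ≥0∞ :=
  ENNReal.ofReal (1 / (2 * Real.pi)) *
    ∫⁻ θ in Set.Icc (0 : ℝ) (2 * Real.pi),
      ENNReal.ofReal (‖f (r * Complex.exp (θ * Complex.I))‖ ^ p)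

/-- The Hardy norm `‖f‖_{H^p}`, with values in `[0,∞]`. For analytic `f` the integral means are
nondecreasing in `r`, so that the upper limit is a limit. -/
def hardyNorm (p : ℝ) (f : ℂ → ℂ) : ℝ≥0∞ :=
  (limsup (fun r : ℝ => circleMean p f r ^ (1 / p)) (𝓝[<] (1 : ℝ)))

/-- Membership in the Hardy space `H^p` of the unit disc. -/
def MemHardy (p : ℝ) (f : ℂ → ℂ) : Prop :=
  DifferentiableOn ℂ f disc ∧ hardyNorm p f < ∞

/-- `μ` is a Carleson measure on the unit disc (tested on the Hardy space `H^p`):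
`∫_𝔻 |f|^p dμ ≤ C ‖f‖_{H^p}^p` for all `f ∈ H^p`. -/
def IsCarlesonMeasure (p : ℝ) (μ : Measure ℂ) : Prop :=
  ∃ C : ℝ≥0, 0 < C ∧ ∀ f : ℂ → ℂ, MemHardy p f →
    ∫⁻ z in disc, ENNReal.ofReal (‖f z‖ ^ p) ∂μ ≤ C * hardyNorm p f ^ p

/-- The measure `|A(z)| (1 - |z|²) dm(z)` on the unit disc, `dm` being Lebesgue area measure. -/
def coeffMeasure (A : ℂ → ℂ) : Measure ℂ :=
  (volume.restrict disc).withDensity fun z => ENNReal.ofReal (‖A z‖ * (1 - ‖z‖ ^ 2))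

/-- `f` is an (analytic) solution of `f'' + A f = 0` in the unit disc. -/
def IsSolution (A f : ℂ → ℂ) : Prop :=
  DifferentiableOn ℂ f disc ∧ ∀ z ∈ disc, deriv (deriv f) z + A z * f z = 0

/-- The family `z` (finite or infinite) lists the zeros of `f` in the unit disc,
each one as many times as its multiplicity. -/
def IsZeroSequence {ι : Type*} (f : ℂ → ℂ) (z : ι → ℂ) : Prop :=
  (∀ i, z i ∈ disc) ∧ ∀ w ∈ disc, {i | z i = w}.encard = analyticOrderAt f w

/-- The pseudo-hyperbolic distance `|z - w| / |1 - z̄ w|`. -/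
def pseudoDist (z w : ℂ) : ℝ :=
  ‖(z - w) / (1 - conj z * w)‖

/-- `inf_k ∏_{n ≠ k} |z_n - z_k| / |1 - z̄_n z_k| > 0`, the products being required to exist
(for points of the disc they always do, as the factors lie in `[0,1]`; they may be `0`). -/
def UniformlySeparated {ι : Type*} (z : ι → ℂ) : Prop :=
  ∃ δ : ℝ, 0 < δ ∧ ∀ k : ι,
    Multipliable (fun n : {n : ι // n ≠ k} => pseudoDist (z n) (z k)) ∧
      δ ≤ ∏' n : {n : ι // n ≠ k}, pseudoDist (z n) (z k)

end DiskODE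

end

namespace DiskODE

/-! Fix a zero `a` of `f` and move it to the origin by the automorphism `φ = moebius a`. Up to a
constant, `u = f(φ) φ'^{-1/2}` solves `u'' + B u = 0` with `B = A(φ) φ'^2`, and `u 0 = 0`. Conformal
invariance (`lintegral_pullback`) turns `∫ |B| (1 - |z|²) dm` into a Poisson integral of the
coefficient measure. Testing the Carleson condition on `p`-th roots of Poisson kernels bounds it by
a constant `C` independent of `a`.

Along each radius, Grönwall (`norm_le_of_second_order`) bounds `log |u(r e^{iθ}) / (r u'(0))|` by
`∫₀^r s (1 - s²) |B(s e^{iθ})| ds`. The factor `s` is the polar Jacobian, so integrating over `θ`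
gives at most `C`. Jensen's formula for `u / (z u'(0))`, whose value at `0` is `1`, then yields `∑
log (1 / |w|) ≤ C / 2π` over the nonzero zeros `w` of `u` (`exp_le_prod_norm_zeros`). The moduli
`|w|` are the pseudo-hyperbolic distances from `a` to the other zeros of `f`, so every product is at
least `exp (-C / 2π)`. -/

/-! ### Poisson kernels as test functions for Carleson measures. -/

lemma one_add_mul_ne_zero {b z : ℂ} (h : ‖b‖ * ‖z‖ < 1) : 1 + b * z ≠ 0 := by
  intro h0
  have : ‖b * z‖ = 1 := by
    rw [show b * z = -1 by linear_combination h0]; simp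
  rw [norm_mul] at this
  linarith

lemma re_one_sub_mul_pos {b z : ℂ} (h : ‖b‖ * ‖z‖ < 1) : 0 < (1 - b * z).re := by
  have := (Complex.re_le_norm (b * z)).trans_eq (norm_mul b z)
  simp only [Complex.sub_re, Complex.one_re]
  linarith

lemma one_sub_mul_ne_zero {b z : ℂ} (h : ‖b‖ * ‖z‖ < 1) : 1 - b * z ≠ 0 := fun h0 => by
  simpa [h0] using re_one_sub_mul_pos h

/-- The real part of `(1 + w) / (1 - w)`. -/
lemma re_one_add_div_one_sub {w : ℂ} (hw : 1 - w ≠ 0) :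
    ((1 + w) / (1 - w)).re = (1 - ‖w‖ ^ 2) / ‖1 - w‖ ^ 2 := by
  rw [← Complex.normSq_eq_norm_sq, ← Complex.normSq_eq_norm_sq]
  have h : Complex.normSq (1 - w) ≠ 0 := by simpa [Complex.normSq_eq_zero] using hw
  rw [Complex.div_re]
  field_simp
  simp [Complex.normSq_apply]
  ring

/-- The Poisson kernel has mean one. -/
lemma circleAverage_poisson {b : ℂ} {r : ℝ} (hr : 0 ≤ r) (h : ‖b‖ * r < 1) :
    Real.circleAverage (fun z => (1 - (‖b‖ * r) ^ 2) / ‖1 - b * z‖ ^ 2) 0 r = 1 := by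
  have hd : ∀ z ∈ Metric.closedBall (0 : ℂ) r, 1 - b * z ≠ 0 := by
    intro z hz
    refine one_sub_mul_ne_zero (lt_of_le_of_lt ?_ h)
    gcongr
    simpa using hz
  -- The Herglotz function: its real part on the circle is the kernel, so the mean value property
  -- gives `Re g(0) = 1`.
  set g : ℂ → ℂ := fun z => (1 + b * z) / (1 - b * z) with hg
  have hgd : ∀ z ∈ Metric.closedBall (0 : ℂ) r, DifferentiableAt ℂ g z := by
    intro z hz
    have := hd z hz
    fun_prop (disch := assumption)
  have hgc : ContinuousOn g (Metric.closedBall (0 : ℂ) r) :=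
    fun z hz => (hgd z hz).continuousAt.continuousWithinAt
  have h1 : Real.circleAverage g 0 r = g 0 :=
    circleAverage_of_differentiable_on_off_countable Set.countable_empty
      (by rwa [abs_of_nonneg hr])
      (fun z hz => hgd z (Metric.ball_subset_closedBall (by
        simpa [abs_of_nonneg hr] using hz)))
  have hci : CircleIntegrable g 0 r :=
    (hgc.mono Metric.sphere_subset_closedBall).circleIntegrable hr
  have h2 := Complex.reCLM.circleAverage_comp_comm hci
  rw [h1] at h2
  have h3 : Complex.reCLM (g 0) = 1 := by simp [hg]
  refine Eq.trans ?_ (h2.trans h3)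
  refine Real.circleAverage_congr_sphere fun z hz => ?_
  rw [abs_of_nonneg hr] at hz
  have hz' : ‖z‖ = r := by simpa using hz
  simp only [hg, Function.comp, Complex.reCLM_apply]
  rw [re_one_add_div_one_sub (hd z (Metric.sphere_subset_closedBall hz)), norm_mul, hz']

/-- The `p`-th root of the Poisson kernel at `a`. -/
noncomputable def poissonRoot (p : ℝ) (a w : ℂ) : ℂ :=
  ((1 - ‖a‖ ^ 2 : ℝ) : ℂ) ^ ((1 / p : ℝ) : ℂ) * (1 - conj a * w) ^ ((-2 / p : ℝ) : ℂ)

lemma norm_conj_mul_norm_lt {a w : ℂ} (ha : ‖a‖ < 1) (hw : ‖w‖ < 1) : ‖conj a‖ * ‖w‖ < 1 := by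
  rw [RCLike.norm_conj]
  nlinarith [norm_nonneg a, norm_nonneg w]

lemma norm_poissonRoot_rpow {p : ℝ} (hp : 0 < p) {a w : ℂ} (ha : ‖a‖ < 1) (hw : ‖w‖ < 1) :
    ‖poissonRoot p a w‖ ^ p = (1 - ‖a‖ ^ 2) / ‖1 - conj a * w‖ ^ 2 := by
  have h0 : 0 ≤ 1 - ‖a‖ ^ 2 := by nlinarith [norm_nonneg a]
  have h1 : 0 < ‖1 - conj a * w‖ :=
    norm_pos_iff.2 (one_sub_mul_ne_zero (norm_conj_mul_norm_lt ha hw))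
  rw [poissonRoot, norm_mul, Complex.norm_cpow_real, Complex.norm_cpow_real,
    Real.mul_rpow (by positivity) (by positivity), ← Real.rpow_mul (by positivity),
    ← Real.rpow_mul (by positivity), Complex.norm_real, Real.norm_of_nonneg h0]
  rw [one_div_mul_cancel hp.ne', div_mul_cancel₀ _ hp.ne', Real.rpow_one, Real.rpow_neg h1.le,
    div_eq_mul_inv]
  norm_cast

/-- The principal branch is analytic here because `1 - āw` stays in the right half-plane. -/
lemma differentiableOn_poissonRoot (p : ℝ) {a : ℂ} (ha : ‖a‖ < 1) :
    DifferentiableOn ℂ (poissonRoot p a) disc := by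
  intro w hw
  have hw' : ‖w‖ < 1 := by simpa using hw
  refine (DifferentiableAt.const_mul ?_ _).differentiableWithinAt
  refine DifferentiableAt.cpow (by fun_prop) (by fun_prop) (Or.inl ?_)
  exact re_one_sub_mul_pos (norm_conj_mul_norm_lt ha hw')

/-- The mean is exactly `(1 - |a|²) / (1 - |a|² r²)`, by rescaling the Poisson kernel of parameter
`|a| r`. -/
lemma circleMean_poissonRoot_le {p : ℝ} (hp : 0 < p) {a : ℂ} (ha : ‖a‖ < 1) {r : ℝ}
    (hr : 0 ≤ r) (hr1 : r < 1) : circleMean p (poissonRoot p a) r ≤ 1 := by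
  have har : ‖conj a‖ * r < 1 := by
    rw [RCLike.norm_conj]; nlinarith [norm_nonneg a]
  have hcm : ∀ θ : ℝ, ‖circleMap 0 r θ‖ < 1 := fun θ => by
    simpa [abs_of_nonneg hr] using hr1
  set F : ℝ → ℝ := fun θ => (1 - ‖a‖ ^ 2) / ‖1 - conj a * circleMap 0 r θ‖ ^ 2 with hF
  have h1 : ∀ θ, 1 - conj a * circleMap 0 r θ ≠ 0 := fun θ =>
    one_sub_mul_ne_zero (norm_conj_mul_norm_lt ha (hcm θ))
  have hFc : Continuous F := by
    refine Continuous.div continuous_const (by fun_prop) fun θ => ?_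
    simpa using h1 θ
  have h0 : 0 ≤ 1 - ‖a‖ ^ 2 := by nlinarith [norm_nonneg a]
  have hF0 : ∀ θ, 0 ≤ F θ := fun θ => by positivity
  have h2 : circleMean p (poissonRoot p a) r =
      ENNReal.ofReal ((2 * Real.pi)⁻¹ * ∫ θ in (0 : ℝ)..2 * Real.pi, F θ) := by
    rw [circleMean, ENNReal.ofReal_mul (by positivity),
      intervalIntegral.integral_of_le Real.two_pi_pos.le, ← integral_Icc_eq_integral_Ioc,
      ofReal_integral_eq_lintegral_ofReal (hFc.integrableOn_Icc) (Eventually.of_forall hF0),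
      one_div]
    congr 2
    ext θ
    have := norm_poissonRoot_rpow hp ha (hcm θ)
    rw [circleMap_zero] at this
    simp only [this, hF, circleMap_zero]
  rw [h2, ← ENNReal.ofReal_one]
  refine ENNReal.ofReal_le_ofReal ?_
  have h3 := circleAverage_poisson hr har
  rw [Real.circleAverage_def, smul_eq_mul] at h3
  rw [← h3]
  refine mul_le_mul_of_nonneg_left ?_ (by positivity)
  refine intervalIntegral.integral_mono_on Real.two_pi_pos.le hFc.continuousOn.intervalIntegrable
    (Continuous.intervalIntegrable (Continuous.div continuous_const (by fun_prop) fun θ => ?_) _ _)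
    fun θ _ => ?_
  · simpa using h1 θ
  · simp only [hF]
    gcongr
    rw [RCLike.norm_conj]
    nlinarith [norm_nonneg a]

lemma hardyNorm_poissonRoot_le {p : ℝ} (hp : 0 < p) {a : ℂ} (ha : ‖a‖ < 1) :
    hardyNorm p (poissonRoot p a) ≤ 1 := by
  refine limsup_le_of_le (by isBoundedDefault) ?_
  filter_upwards [Ioo_mem_nhdsLT (zero_lt_one' ℝ)] with r hr
  exact ENNReal.rpow_le_one (circleMean_poissonRoot_le hp ha hr.1.le hr.2) (by positivity)

/-- A Carleson measure has bounded Poisson integrals. -/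
theorem IsCarlesonMeasure.exists_lintegral_poisson_le {p : ℝ} (hp : 0 < p) {μ : Measure ℂ}
    (h : IsCarlesonMeasure p μ) :
    ∃ C : ℝ≥0, ∀ a : ℂ, ‖a‖ < 1 →
      ∫⁻ w in disc, ENNReal.ofReal ((1 - ‖a‖ ^ 2) / ‖1 - conj a * w‖ ^ 2) ∂μ ≤ C := by
  obtain ⟨C, -, hC⟩ := h
  refine ⟨C, fun a ha => ?_⟩
  have h1 := hardyNorm_poissonRoot_le hp ha
  calc _ = ∫⁻ w in disc, ENNReal.ofReal (‖poissonRoot p a w‖ ^ p) ∂μ := by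
        refine setLIntegral_congr_fun measurableSet_ball fun w hw => ?_
        rw [norm_poissonRoot_rpow hp ha (by simpa using hw)]
    _ ≤ C * hardyNorm p (poissonRoot p a) ^ p :=
        hC _ ⟨differentiableOn_poissonRoot p ha, h1.trans_lt ENNReal.one_lt_top⟩
    _ ≤ C * 1 := by gcongr; exact ENNReal.rpow_le_one h1 hp.le
    _ = C := mul_one _

/-! ### Growth of solutions on an interval. -/

/-- Grönwall's estimate for `U'' = b U`, `U 0 = 0`, on an interval contained in `[0, 1)`. -/
theorem norm_le_of_second_order {U U' b : ℝ → ℂ} {r : ℝ} (hr0 : 0 ≤ r) (hr1 : r < 1)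
    (hb : ContinuousOn b (Set.Ioo (-1) 1))
    (hU : ∀ s ∈ Set.Ioo (-1 : ℝ) 1, HasDerivAt U (U' s) s)
    (hU' : ∀ s ∈ Set.Ioo (-1 : ℝ) 1, HasDerivAt U' (b s * U s) s) (h0 : U 0 = 0) :
    ‖U r‖ ≤ r * ‖U' 0‖ * Real.exp (∫ s in (0 : ℝ)..r, s * (1 - s) * ‖b s‖) := by
  have hUc : ContinuousOn U (Set.Ioo (-1) 1) :=
    fun s hs => (hU s hs).continuousAt.continuousWithinAt
  have hsub : ∀ {t : ℝ}, 0 ≤ t → t < 1 → Set.uIcc 0 t ⊆ Set.Ioo (-1) 1 := by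
    intro t ht0 ht1 s hs
    rw [Set.uIcc_of_le ht0] at hs
    exact ⟨by linarith [hs.1], by linarith [hs.2]⟩
  -- primitives of continuous functions on `(-1, 1)`
  have hprim : ∀ {g : ℝ → ℝ}, ContinuousOn g (Set.Ioo (-1) 1) → ∀ t ∈ Set.Ico (0 : ℝ) 1,
      HasDerivAt (fun x => ∫ s in (0 : ℝ)..x, g s) (g t) t := by
    intro g hg t ht
    have htm : t ∈ Set.Ioo (-1 : ℝ) 1 := ⟨by linarith [ht.1], ht.2⟩
    refine intervalIntegral.integral_hasDerivAt_right
      (hg.mono (hsub ht.1 ht.2)).intervalIntegrable ?_ (hg.continuousAt (Ioo_mem_nhds htm.1 htm.2))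
    exact ContinuousOn.stronglyMeasurableAtFilter isOpen_Ioo hg t htm
  set g : ℝ → ℝ := fun s => (1 - s) * (‖b s‖ * ‖U s‖) with hgdef
  set k : ℝ → ℝ := fun s => s * (1 - s) * ‖b s‖ with hkdef
  have hgc : ContinuousOn g (Set.Ioo (-1) 1) := by fun_prop
  have hkc : ContinuousOn k (Set.Ioo (-1) 1) := by fun_prop
  -- The Grönwall majorant of `‖U t‖ / t`. Dividing by `t` is what puts the factor `s` into `k`.
  set y : ℝ → ℝ := fun t => ‖U' 0‖ + ∫ s in (0 : ℝ)..t, g s with hydef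
  -- Taylor's formula with integral remainder
  have hle : ∀ t ∈ Set.Ico (0 : ℝ) 1, ‖U t‖ ≤ t * y t := by
    intro t ht
    have hd : ∀ s ∈ Set.uIcc 0 t,
        HasDerivAt (fun s : ℝ => ((t : ℂ) - s) * U' s + U s) (((t : ℂ) - s) * (b s * U s)) s := by
      intro s hs
      have hs' := hsub ht.1 ht.2 hs
      have h1 : HasDerivAt (fun s : ℝ => (t : ℂ) - s) (-1) s := by
        simpa using (Complex.ofRealCLM.hasDerivAt (x := s)).const_sub (t : ℂ)
      convert! (h1.mul (hU' s hs')).add (hU s hs') using 1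
      ring
    have hint : ContinuousOn (fun s : ℝ => ((t : ℂ) - s) * (b s * U s)) (Set.Ioo (-1) 1) := by
      fun_prop
    have hT := intervalIntegral.integral_eq_sub_of_hasDerivAt hd
      (hint.mono (hsub ht.1 ht.2)).intervalIntegrable
    have hUt : U t = t * U' 0 + ∫ s in (0 : ℝ)..t, ((t : ℂ) - s) * (b s * U s) := by
      rw [hT, h0]; simp
    rw [hUt, hydef, mul_add, ← intervalIntegral.integral_const_mul]
    refine (norm_add_le _ _).trans (add_le_add ?_ ?_)
    · rw [norm_mul, Complex.norm_real, Real.norm_of_nonneg ht.1]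
    · refine intervalIntegral.norm_integral_le_of_norm_le ht.1 (Eventually.of_forall fun s hs => ?_)
        ((hgc.const_mul t).mono (hsub ht.1 ht.2)).intervalIntegrable
      rw [norm_mul, norm_mul, ← Complex.ofReal_sub, Complex.norm_real,
        Real.norm_of_nonneg (by linarith [hs.2])]
      simp only [hgdef]
      rw [← mul_assoc t]
      gcongr
      -- `t - s ≤ t (1 - s)` because `t < 1`: this is the source of the Carleson weight.
      nlinarith [hs.1, hs.2, ht.2]
  set K : ℝ → ℝ := fun t => ∫ s in (0 : ℝ)..t, k s with hKdef
  -- Integrating factor: `y' = g ≤ k y`, by `hle`.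
  have hanti : AntitoneOn (fun t => y t * Real.exp (-K t)) (Set.Icc 0 r) := by
    have hd : ∀ t ∈ Set.Icc 0 r, HasDerivAt (fun t => y t * Real.exp (-K t))
        (g t * Real.exp (-K t) + y t * (Real.exp (-K t) * -k t)) t := by
      intro t ht
      have ht' : t ∈ Set.Ico (0 : ℝ) 1 := ⟨ht.1, ht.2.trans_lt hr1⟩
      exact ((hprim hgc t ht').const_add _).mul (hprim hkc t ht').neg.exp
    refine antitoneOn_of_deriv_nonpos (convex_Icc 0 r)
      (fun t ht => (hd t ht).continuousAt.continuousWithinAt)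
      (fun t ht => (hd t (interior_subset ht)).differentiableAt.differentiableWithinAt)
      fun t ht => ?_
    have ht := interior_subset ht
    rw [(hd t ht).deriv]
    have h1 : 0 ≤ 1 - t := by linarith [ht.2]
    have h2 : g t ≤ y t * k t := by
      calc g t ≤ (1 - t) * (‖b t‖ * (t * y t)) := by
            simp only [hgdef]
            gcongr
            exact hle t ⟨ht.1, ht.2.trans_lt hr1⟩
        _ = y t * k t := by rw [hkdef]; ring
    nlinarith [Real.exp_pos (-K t)]
  have h1 := hanti (Set.left_mem_Icc.2 hr0) (Set.right_mem_Icc.2 hr0) hr0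
  have h2 : y r ≤ ‖U' 0‖ * Real.exp (K r) := by
    simp only [hydef, hKdef, intervalIntegral.integral_same, neg_zero, Real.exp_zero, add_zero,
      mul_one] at h1
    rw [Real.exp_neg, ← div_eq_mul_inv, div_le_iff₀ (Real.exp_pos _)] at h1
    exact h1
  calc ‖U r‖ ≤ r * y r := hle r ⟨hr0, hr1⟩
    _ ≤ r * (‖U' 0‖ * Real.exp (K r)) := by gcongr
    _ = _ := by ring

/-! ### Infinite products and Jensen's inequality. -/

/-- A family with values in `[0, 1]` whose finite products are bounded below by `δ` is
multipliable, and its product is at least `δ`. -/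
lemma multipliable_of_le_finset_prod {κ : Type*} {x : κ → ℝ} {δ : ℝ} (h0 : ∀ i, 0 ≤ x i)
    (h1 : ∀ i, x i ≤ 1) (hδ : ∀ s : Finset κ, δ ≤ ∏ i ∈ s, x i) :
    Multipliable x ∧ δ ≤ ∏' i, x i := by
  classical
  have hanti : Antitone fun s : Finset κ => ∏ i ∈ s, x i := fun s t hst =>
    Finset.prod_le_prod_of_subset_of_le_one hst (fun i _ => h0 i) (fun i _ _ => h1 i)
  have hlim : HasProd x (⨅ s : Finset κ, ∏ i ∈ s, x i) :=
    tendsto_atTop_ciInf hanti ⟨δ, by rintro _ ⟨s, rfl⟩; exact hδ s⟩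
  exact ⟨hlim.multipliable, hlim.tprod_eq ▸ le_ciInf hδ⟩

/-- Jensen's inequality for finitely many zeros. -/
lemma sum_log_le_circleAverage {g : ℂ → ℂ} {r : ℝ} (hr : 0 < r)
    (hg : AnalyticOnNhd ℂ g (Metric.closedBall 0 r)) (h0 : g 0 ≠ 0) (F : Finset ℂ)
    (hF : ∀ w ∈ F, ‖w‖ ≤ r ∧ g w = 0) :
    ∑ w ∈ F, Real.log (r / ‖w‖) + Real.log ‖g 0‖ ≤ Real.circleAverage (Real.log ‖g ·‖) 0 r := by
  have hR : |r| = r := abs_of_pos hr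
  rw [AnalyticOnNhd.circleAverage_log_norm hr.ne' (by rwa [hR]) h0, hR]
  gcongr
  set D := MeromorphicOn.divisor g (Metric.closedBall 0 r) with hD
  have hfin : (fun u => (D u : ℝ) * Real.log (r * ‖0 - u‖⁻¹)).HasFiniteSupport := by
    refine (D.finiteSupport (isCompact_closedBall _ _)).subset fun u hu => ?_
    simp only [Function.mem_support] at hu ⊢
    intro h
    simp [h] at hu
  have hDnn : ∀ u, 0 ≤ D u := fun u => MeromorphicOn.AnalyticOnNhd.divisor_nonneg hg u
  have hlog : ∀ u ∈ Metric.closedBall (0 : ℂ) r, 0 ≤ Real.log (r * ‖0 - u‖⁻¹) := by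
    intro u hu
    have hu' : ‖u‖ ≤ r := by simpa using hu
    rcases eq_or_ne u 0 with rfl | hne
    · simp
    · have : 0 < ‖u‖ := norm_pos_iff.2 hne
      rw [zero_sub, norm_neg, ← div_eq_mul_inv]
      exact Real.log_nonneg ((one_le_div this).2 hu')
  have hnn : ∀ u, 0 ≤ (D u : ℝ) * Real.log (r * ‖0 - u‖⁻¹) := by
    intro u
    by_cases hu : u ∈ Metric.closedBall (0 : ℂ) r
    · exact mul_nonneg (by exact_mod_cast hDnn u) (hlog u hu)
    · simp [D.apply_eq_zero_of_notMem hu]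
  -- A zero of infinite order would force `g 0 = 0` by the identity theorem.
  have hne_top : ∀ w ∈ Metric.closedBall (0 : ℂ) r, analyticOrderAt g w ≠ ⊤ := by
    intro w hw htop
    have := hg.eqOn_zero_of_preconnected_of_eventuallyEq_zero
      (convex_closedBall _ _).isPreconnected hw (analyticOrderAt_eq_top.1 htop)
    exact h0 (this (Metric.mem_closedBall_self hr.le))
  have hone : ∀ w ∈ F, 1 ≤ D w := by
    intro w hw
    obtain ⟨hwr, hgw⟩ := hF w hw
    have hwm : w ∈ Metric.closedBall (0 : ℂ) r := by simpa using hwr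
    rw [hD, MeromorphicOn.AnalyticOnNhd.divisor_apply hg hwm]
    have h1 : analyticOrderAt g w ≠ 0 := fun h => (hg w hwm).analyticOrderAt_eq_zero.1 h hgw
    lift analyticOrderAt g w to ℕ using hne_top w hwm with n hn
    have : n ≠ 0 := by simpa using h1
    simp
    omega
  rw [finsum_eq_sum_of_support_subset (s := hfin.toFinset ∪ F) _ (by
    simp [Set.subset_union_left])]
  calc ∑ w ∈ F, Real.log (r / ‖w‖)
      ≤ ∑ w ∈ F, (D w : ℝ) * Real.log (r * ‖0 - w‖⁻¹) := by
        refine Finset.sum_le_sum fun w hw => ?_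
        have h1 := hlog w (by simpa using (hF w hw).1)
        have h2 : (1 : ℝ) ≤ D w := by exact_mod_cast hone w hw
        calc Real.log (r / ‖w‖) = Real.log (r * ‖0 - w‖⁻¹) := by simp [div_eq_mul_inv]
          _ ≤ _ := le_mul_of_one_le_left h1 h2
    _ ≤ _ := Finset.sum_le_sum_of_subset_of_nonneg Finset.subset_union_right fun u _ _ => hnn u

/-! ### Automorphisms of the disc. -/

/-- The automorphism `z ↦ (a + z) / (1 + ā z)` of the disc, taking `0` to `a`. -/
noncomputable def moebius (a z : ℂ) : ℂ := (a + z) / (1 + conj a * z)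

/-- The derivative of `moebius a`. -/
noncomputable def moebiusDeriv (a z : ℂ) : ℂ := (1 - a * conj a) / (1 + conj a * z) ^ 2

section moebius

variable {a z : ℂ}

lemma moebius_zero (a : ℂ) : moebius a 0 = a := by simp [moebius]

lemma one_add_conj_mul_ne_zero (ha : ‖a‖ < 1) (hz : ‖z‖ < 1) : 1 + conj a * z ≠ 0 :=
  one_add_mul_ne_zero (norm_conj_mul_norm_lt ha hz)

lemma one_sub_conj_mul_ne_zero (ha : ‖a‖ < 1) (hz : ‖z‖ < 1) : 1 - conj a * z ≠ 0 :=
  one_sub_mul_ne_zero (norm_conj_mul_norm_lt ha hz)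

lemma norm_one_sub_mul_conj (ha : ‖a‖ < 1) : ‖1 - a * conj a‖ = 1 - ‖a‖ ^ 2 := by
  rw [Complex.mul_conj, Complex.normSq_eq_norm_sq, ← Complex.ofReal_one, ← Complex.ofReal_sub,
    Complex.norm_real, Real.norm_of_nonneg (by nlinarith [norm_nonneg a])]

lemma one_sub_mul_conj_ne_zero (ha : ‖a‖ < 1) : 1 - a * conj a ≠ 0 := by
  rw [mul_comm]
  exact one_sub_conj_mul_ne_zero ha ha

lemma hasDerivAt_moebius (ha : ‖a‖ < 1) (hz : ‖z‖ < 1) :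
    HasDerivAt (moebius a) (moebiusDeriv a z) z := by
  have h := one_add_conj_mul_ne_zero ha hz
  have h1 : HasDerivAt (fun z => a + z) 1 z := (hasDerivAt_id z).const_add a
  have h2 : HasDerivAt (fun z => 1 + conj a * z) (conj a) z := by
    simpa using ((hasDerivAt_id z).const_mul (conj a)).const_add 1
  refine (h1.div h2 h).congr_deriv ?_
  rw [moebiusDeriv]
  ring

lemma one_sub_norm_moebius_sq (ha : ‖a‖ < 1) (hz : ‖z‖ < 1) :
    1 - ‖moebius a z‖ ^ 2 = (1 - ‖a‖ ^ 2) * (1 - ‖z‖ ^ 2) / ‖1 + conj a * z‖ ^ 2 := by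
  have h : ‖1 + conj a * z‖ ^ 2 ≠ 0 :=
    pow_ne_zero 2 (norm_ne_zero_iff.2 (one_add_conj_mul_ne_zero ha hz))
  rw [moebius, norm_div, div_pow, eq_div_iff h, sub_mul, div_mul_cancel₀ _ h]
  simp only [← Complex.normSq_eq_norm_sq, Complex.normSq_apply, Complex.add_re, Complex.add_im,
    Complex.mul_re, Complex.mul_im, Complex.conj_re, Complex.conj_im, Complex.one_re,
    Complex.one_im]
  ring

lemma norm_moebius_lt_one (ha : ‖a‖ < 1) (hz : ‖z‖ < 1) : ‖moebius a z‖ < 1 := by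
  have h : 0 < ‖1 + conj a * z‖ := norm_pos_iff.2 (one_add_conj_mul_ne_zero ha hz)
  have h1 := one_sub_norm_moebius_sq ha hz
  have h2 : 0 < 1 - ‖a‖ ^ 2 := by nlinarith [norm_nonneg a]
  have h3 : 0 < 1 - ‖z‖ ^ 2 := by nlinarith [norm_nonneg z]
  have h4 : 0 < 1 - ‖moebius a z‖ ^ 2 := by rw [h1]; positivity
  nlinarith [norm_nonneg (moebius a z)]

lemma one_sub_conj_mul_moebius (ha : ‖a‖ < 1) (hz : ‖z‖ < 1) :
    1 - conj a * moebius a z = (1 - a * conj a) / (1 + conj a * z) := by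
  have h := one_add_conj_mul_ne_zero ha hz
  rw [moebius]
  field_simp
  ring

lemma moebius_neg_moebius (ha : ‖a‖ < 1) (hz : ‖z‖ < 1) : moebius (-a) (moebius a z) = z := by
  have h := one_add_conj_mul_ne_zero ha hz
  have h' := one_sub_mul_conj_ne_zero ha
  have h1 := one_sub_conj_mul_moebius ha hz
  rw [moebius, map_neg, neg_mul, ← sub_eq_add_neg, h1, moebius, div_div_eq_mul_div,
    div_eq_iff h', add_mul, div_mul_cancel₀ _ h]
  ring

lemma moebius_moebius_neg (ha : ‖a‖ < 1) (hz : ‖z‖ < 1) : moebius a (moebius (-a) z) = z := by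
  simpa using moebius_neg_moebius (a := -a) (by simpa using ha) hz

lemma injOn_moebius (ha : ‖a‖ < 1) : Set.InjOn (moebius a) disc := by
  intro z hz w hw h
  rw [disc, mem_ball_zero_iff] at hz hw
  rw [← moebius_neg_moebius ha hz, h, moebius_neg_moebius ha hw]

lemma image_moebius (ha : ‖a‖ < 1) : moebius a '' disc = disc := by
  have ha' : ‖-a‖ < 1 := by simpa using ha
  ext w
  simp only [disc, Set.mem_image, mem_ball_zero_iff]
  constructor
  · rintro ⟨z, hz, rfl⟩
    exact norm_moebius_lt_one ha hz
  · exact fun hw => ⟨_, norm_moebius_lt_one ha' hw, moebius_moebius_neg ha hw⟩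

end moebius

/-! ### Conformal invariance and polar coordinates. -/

/-- Change of variables for a complex differentiable injective map. -/
lemma lintegral_image_eq_lintegral_norm_sq_mul {s : Set ℂ} (hs : MeasurableSet s) {φ φ' : ℂ → ℂ}
    (hφ : ∀ z ∈ s, HasDerivAt φ (φ' z) z) (hinj : Set.InjOn φ s) (g : ℂ → ℝ≥0∞) :
    ∫⁻ w in φ '' s, g w = ∫⁻ z in s, ENNReal.ofReal (‖φ' z‖ ^ 2) * g (φ z) := by
  have h := lintegral_image_eq_lintegral_abs_det_fderiv_mul volume hs
    (f' := fun z => (ContinuousLinearMap.toSpanSingleton ℂ (φ' z)).restrictScalars ℝ)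
    (fun z hz => ((hφ z hz).hasFDerivAt.restrictScalars ℝ).hasFDerivWithinAt) hinj g
  rw [h]
  refine setLIntegral_congr_fun hs fun z _ => ?_
  have : ((ContinuousLinearMap.toSpanSingleton ℂ (φ' z)).restrictScalars ℝ).det = ‖φ' z‖ ^ 2 := by
    simp [ContinuousLinearMap.det, LinearMap.det_restrictScalars, Algebra.norm_complex_eq,
      Complex.normSq_eq_norm_sq]
  simp only [this, abs_pow, abs_norm]

lemma lintegral_coeffMeasure {A : ℂ → ℂ} (hA : ContinuousOn A disc) {g : ℂ → ℝ}
    (hg : ContinuousOn g disc) :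
    ∫⁻ w in disc, ENNReal.ofReal (g w) ∂(coeffMeasure A) =
      ∫⁻ w in disc, ENNReal.ofReal (‖A w‖ * (1 - ‖w‖ ^ 2) * g w) := by
  have hAc : ContinuousOn (fun w => ‖A w‖ * (1 - ‖w‖ ^ 2)) disc := by fun_prop
  rw [coeffMeasure, restrict_withDensity measurableSet_ball,
    Measure.restrict_restrict measurableSet_ball, Set.inter_self,
    lintegral_withDensity_eq_lintegral_mul₀
      (hAc.aemeasurable measurableSet_ball).ennreal_ofReal
      (hg.aemeasurable measurableSet_ball).ennreal_ofReal]
  refine setLIntegral_congr_fun measurableSet_ball fun w hw => ?_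
  have hw' : ‖w‖ < 1 := by simpa using hw
  rw [Pi.mul_apply, ← ENNReal.ofReal_mul]
  have : 0 ≤ 1 - ‖w‖ ^ 2 := by nlinarith [norm_nonneg w]
  positivity

/-- The coefficient `A(φ) φ'²`, where `φ` is `moebius a`. -/
noncomputable def pullback (A : ℂ → ℂ) (a z : ℂ) : ℂ := A (moebius a z) * moebiusDeriv a z ^ 2

/-- With `w = φ(z)`, the Jacobian is `|φ'|²`, while `1 - |w|² = |φ'| (1 - |z|²)` and the Poisson
kernel equals `1 / |φ'|`; the last two powers of `|φ'|` cancel. -/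
lemma lintegral_pullback {A : ℂ → ℂ} (hA : ContinuousOn A disc) {a : ℂ} (ha : ‖a‖ < 1) :
    ∫⁻ z in disc, ENNReal.ofReal (‖pullback A a z‖ * (1 - ‖z‖ ^ 2)) =
      ∫⁻ w in disc, ENNReal.ofReal ((1 - ‖a‖ ^ 2) / ‖1 - conj a * w‖ ^ 2) ∂(coeffMeasure A) := by
  have hc : ContinuousOn (fun w => (1 - ‖a‖ ^ 2) / ‖1 - conj a * w‖ ^ 2) disc := by
    refine ContinuousOn.div continuousOn_const (by fun_prop) fun w hw => ?_
    simpa using one_sub_conj_mul_ne_zero ha (by simpa using hw)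
  rw [lintegral_coeffMeasure hA hc]
  conv_rhs => rw [← image_moebius ha]
  rw [lintegral_image_eq_lintegral_norm_sq_mul measurableSet_ball
    (fun z hz => hasDerivAt_moebius ha (by simpa using hz)) (injOn_moebius ha)]
  refine setLIntegral_congr_fun measurableSet_ball fun z hz => ?_
  have hz' : ‖z‖ < 1 := by simpa using hz
  rw [← ENNReal.ofReal_mul (by positivity), one_sub_conj_mul_moebius ha hz',
    one_sub_norm_moebius_sq ha hz', norm_div, norm_one_sub_mul_conj ha, pullback, norm_mul,
    norm_pow]
  congr 1
  have h1 : ‖1 + conj a * z‖ ≠ 0 := norm_ne_zero_iff.2 (one_add_conj_mul_ne_zero ha hz')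
  have h2 : 1 - ‖a‖ ^ 2 ≠ 0 := by nlinarith [norm_nonneg a]
  field_simp

lemma continuous_radial_integral {k : ℂ → ℝ} (hk : ContinuousOn k disc) {r : ℝ} (hr : 0 ≤ r)
    (hr1 : r < 1) : Continuous fun θ => ∫ s in (0 : ℝ)..r, s * k (circleMap 0 s θ) := by
  -- Clamping the radius to `[0, r]` makes the integrand continuous on the whole plane of parameters
  -- without changing the integral.
  set c : ℝ → ℝ := fun s => max 0 (min s r) with hc
  have hcont : Continuous fun q : ℝ × ℝ => q.2 * k (circleMap 0 (c q.2) q.1) := by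
    refine continuous_snd.mul (hk.comp_continuous ?_ fun q => ?_)
    · simp only [circleMap, hc]; fun_prop
    · have h0 : 0 ≤ c q.2 := le_max_left _ _
      have h1 : c q.2 ≤ r := max_le hr (min_le_right _ _)
      simpa [abs_of_nonneg h0] using h1.trans_lt hr1
  have h := intervalIntegral.continuous_parametric_intervalIntegral_of_continuous'
    (μ := volume) (f := fun θ s => s * k (circleMap 0 (c s) θ)) hcont 0 r
  convert! h using 2 with θ
  refine intervalIntegral.integral_congr fun s hs => ?_
  rw [Set.uIcc_of_le hr] at hs
  simp only [hc, min_eq_left hs.2, max_eq_right hs.1]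

/-- The integral over the disc in polar coordinates. -/
lemma integral_radial_integral_le {k : ℂ → ℝ} (hk : ContinuousOn k disc)
    (hk0 : ∀ z ∈ disc, 0 ≤ k z) {C : ℝ≥0} (hC : ∫⁻ z in disc, ENNReal.ofReal (k z) ≤ C) {r : ℝ}
    (hr : 0 ≤ r) (hr1 : r < 1) :
    ∫ θ in (0 : ℝ)..2 * Real.pi, ∫ s in (0 : ℝ)..r, s * k (circleMap 0 s θ) ≤ C := by
  set G : ℝ → ℝ := fun θ => ∫ s in (0 : ℝ)..r, s * k (circleMap 0 s θ) with hG
  have hGc : Continuous G := continuous_radial_integral hk hr hr1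
  have hmem : ∀ s ∈ Set.Ioc 0 r, ∀ θ : ℝ, circleMap 0 s θ ∈ disc := fun s hs θ => by
    simpa [abs_of_pos hs.1] using hs.2.trans_lt hr1
  have hG0 : ∀ θ, 0 ≤ G θ := fun θ => by
    rw [hG]
    simp only
    rw [intervalIntegral.integral_of_le hr]
    exact setIntegral_nonneg measurableSet_Ioc fun s hs =>
      mul_nonneg hs.1.le (hk0 _ (hmem s hs θ))
  have hper : Function.Periodic G (2 * Real.pi) := fun θ => by
    simp only [hG, periodic_circleMap 0 _ θ]
  -- Periodicity moves the angle to the range used by `polarCoord`.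
  have h1 : ∫ θ in (0 : ℝ)..2 * Real.pi, G θ = ∫ θ in Set.Ioo (-Real.pi) Real.pi, G θ := by
    have := hper.intervalIntegral_add_eq 0 (-Real.pi)
    rw [zero_add] at this
    rw [this, intervalIntegral.integral_of_le (by linarith [Real.pi_pos]),
      integral_Ioc_eq_integral_Ioo]
    ring_nf
  set H : ℂ → ℝ≥0∞ := disc.indicator fun z => ENNReal.ofReal (k z) with hH
  have hHm : Measurable H := by
    classical
    have := ContinuousOn.measurable_piecewise (f := fun z => ENNReal.ofReal (k z))
      (g := 0) (s := disc) (ENNReal.continuous_ofReal.comp_continuousOn hk)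
      continuousOn_const measurableSet_ball
    rwa [Set.piecewise_eq_indicator] at this
  have hGle : ∀ θ, ENNReal.ofReal (G θ) ≤
      ∫⁻ s in Set.Ioi (0 : ℝ), ENNReal.ofReal s * H (circleMap 0 s θ) := by
    intro θ
    have hci : IntegrableOn (fun s => s * k (circleMap 0 s θ)) (Set.Ioc 0 r) := by
      refine (ContinuousOn.integrableOn_Icc ?_).mono_set Set.Ioc_subset_Icc_self
      refine continuousOn_id.mul (hk.comp ?_ fun s hs => ?_)
      · simp only [circleMap]; fun_prop
      · simpa [abs_of_nonneg hs.1] using hs.2.trans_lt hr1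
    rw [hG]
    simp only
    rw [intervalIntegral.integral_of_le hr, ofReal_integral_eq_lintegral_ofReal hci
      ((ae_restrict_iff' measurableSet_Ioc).2 (Eventually.of_forall fun s hs =>
        mul_nonneg hs.1.le (hk0 _ (hmem s hs θ))))]
    calc _ = ∫⁻ s in Set.Ioc 0 r, ENNReal.ofReal s * H (circleMap 0 s θ) := by
          refine setLIntegral_congr_fun measurableSet_Ioc fun s hs => ?_
          rw [hH, Set.indicator_of_mem (hmem s hs θ), ENNReal.ofReal_mul hs.1.le]
      _ ≤ _ := lintegral_mono_set Set.Ioc_subset_Ioi_self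
  have hpolar : ∫⁻ θ in Set.Ioo (-Real.pi) Real.pi, ∫⁻ s in Set.Ioi (0 : ℝ),
      ENNReal.ofReal s * H (circleMap 0 s θ) = ∫⁻ z, H z := by
    rw [← Complex.lintegral_comp_polarCoord_symm, polarCoord_target, Measure.volume_eq_prod,
      ← Measure.prod_restrict, lintegral_prod_symm]
    · simp only [smul_eq_mul, Complex.polarCoord_symm_apply, circleMap_zero, Complex.exp_mul_I,
        Complex.ofReal_cos, Complex.ofReal_sin]
    · refine Measurable.aemeasurable ?_
      simp only [smul_eq_mul, Complex.polarCoord_symm_apply]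
      exact (by fun_prop : Measurable fun q : ℝ × ℝ => ENNReal.ofReal q.1).mul
        (hHm.comp (by fun_prop))
  refine h1.trans_le ((ENNReal.ofReal_le_ofReal_iff C.2).1 ?_)
  rw [ofReal_integral_eq_lintegral_ofReal
    ((hGc.integrableOn_Icc).mono_set Set.Ioo_subset_Icc_self) (Eventually.of_forall hG0)]
  calc _ ≤ ∫⁻ θ in Set.Ioo (-Real.pi) Real.pi, ∫⁻ s in Set.Ioi (0 : ℝ),
          ENNReal.ofReal s * H (circleMap 0 s θ) := lintegral_mono fun θ => hGle θ
    _ = ∫⁻ z in disc, ENNReal.ofReal (k z) := by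
          rw [hpolar, hH, lintegral_indicator measurableSet_ball]
    _ ≤ _ := by simpa using hC

/-! ### Solutions vanishing at the origin. -/

section normalized

variable {u u' B : ℂ → ℂ}

/-- Growth of a solution of `u'' + B u = 0` with `u 0 = 0` along the radii. -/
lemma norm_solution_le (hB : ContinuousOn B disc) (hu : ∀ z ∈ disc, HasDerivAt u (u' z) z)
    (hu' : ∀ z ∈ disc, HasDerivAt u' (-(B z * u z)) z) (h0 : u 0 = 0) {r : ℝ} (hr : 0 ≤ r)
    (hr1 : r < 1) (θ : ℝ) :
    ‖u (circleMap 0 r θ)‖ ≤ r * ‖u' 0‖ * Real.exp (∫ s in (0 : ℝ)..r,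
      s * (‖B (circleMap 0 s θ)‖ * (1 - ‖circleMap 0 s θ‖ ^ 2))) := by
  set e : ℂ := Complex.exp (θ * Complex.I) with he
  have hne : ‖e‖ = 1 := Complex.norm_exp_ofReal_mul_I θ
  have hcm : ∀ s : ℝ, circleMap 0 s θ = s * e := fun s => circleMap_zero s θ
  have hmem : ∀ s ∈ Set.Ioo (-1 : ℝ) 1, (s : ℂ) * e ∈ disc := fun s hs => by
    simpa [hne, abs_lt] using hs
  have hray : ∀ s : ℝ, HasDerivAt (fun s : ℝ => (s : ℂ) * e) e s := fun s => by
    simpa using (Complex.ofRealCLM.hasDerivAt (x := s)).mul_const e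
  have hBc : ContinuousOn (fun s : ℝ => B (s * e)) (Set.Ioo (-1) 1) :=
    hB.comp (by fun_prop) hmem
  -- Restriction to the ray through `e`: differentiating twice produces `e ^ 2`, of modulus one.
  have h := norm_le_of_second_order (U := fun s : ℝ => u (s * e)) (U' := fun s : ℝ => u' (s * e) * e)
    (b := fun s : ℝ => -(B (s * e) * e ^ 2)) hr hr1 (hBc.mul_const _).neg
    (fun s hs => (hu _ (hmem s hs)).comp s (hray s))
    (fun s hs => (((hu' _ (hmem s hs)).comp s (hray s)).mul_const e).congr_deriv (by ring))
    (by simpa using h0)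
  simp only [norm_mul, norm_neg, norm_pow, hne, one_pow, mul_one, Complex.ofReal_zero,
    zero_mul] at h
  rw [hcm]
  refine h.trans ?_
  have hsub : Set.uIcc 0 r ⊆ Set.Ioo (-1) 1 := fun s hs => by
    rw [Set.uIcc_of_le hr] at hs
    exact ⟨by linarith [hs.1], hs.2.trans_lt hr1⟩
  have hI : ∫ s in (0 : ℝ)..r, s * (1 - s) * ‖B (s * e)‖ ≤ ∫ s in (0 : ℝ)..r,
      s * (‖B (circleMap 0 s θ)‖ * (1 - ‖circleMap 0 s θ‖ ^ 2)) := by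
    simp only [hcm]
    refine intervalIntegral.integral_mono_on hr
      (ContinuousOn.intervalIntegrable (ContinuousOn.mono ?_ hsub))
      (ContinuousOn.intervalIntegrable (ContinuousOn.mono ?_ hsub)) fun s hs => ?_
    · exact (by fun_prop : Continuous fun s : ℝ => s * (1 - s)).continuousOn.mul hBc.norm
    · exact continuousOn_id.mul (hBc.norm.mul
        (by fun_prop : Continuous fun s : ℝ => 1 - ‖(s : ℂ) * e‖ ^ 2).continuousOn)
    · rw [norm_mul, hne, Complex.norm_real, mul_one, Real.norm_of_nonneg hs.1]
      have : 1 - s ≤ 1 - s ^ 2 := by nlinarith [hs.1, hs.2]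
      calc s * (1 - s) * ‖B (s * e)‖ = s * (‖B (s * e)‖ * (1 - s)) := by ring
        _ ≤ _ := by have := hs.1; gcongr
  gcongr

/-- Uniqueness for the initial value problem: the growth bound carries the factor `‖u' 0‖`. -/
lemma eq_zero_of_deriv_eq_zero (hB : ContinuousOn B disc)
    (hu : ∀ z ∈ disc, HasDerivAt u (u' z) z)
    (hu' : ∀ z ∈ disc, HasDerivAt u' (-(B z * u z)) z) (h0 : u 0 = 0) (h0' : u' 0 = 0) :
    ∀ z ∈ disc, u z = 0 := by
  intro z hz
  have h := norm_solution_le hB hu hu' h0 (norm_nonneg z) (by simpa using hz) z.arg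
  rw [h0', norm_zero, mul_zero, zero_mul, circleMap_zero, Complex.norm_mul_exp_arg_mul_I] at h
  exact norm_le_zero_iff.1 h

/-- The zeros of a solution which vanishes at the origin satisfy a Blaschke condition with a
bound depending only on the coefficient. -/
theorem exp_le_prod_norm_zeros (hB : ContinuousOn B disc)
    (hu : ∀ z ∈ disc, HasDerivAt u (u' z) z)
    (hu' : ∀ z ∈ disc, HasDerivAt u' (-(B z * u z)) z) (h0 : u 0 = 0) (h0' : u' 0 ≠ 0)
    {C : ℝ≥0} (hC : ∫⁻ z in disc, ENNReal.ofReal (‖B z‖ * (1 - ‖z‖ ^ 2)) ≤ C)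
    (F : Finset ℂ) (hF : ∀ w ∈ F, ‖w‖ < 1 ∧ w ≠ 0 ∧ u w = 0) :
    Real.exp (-((2 * Real.pi)⁻¹ * C)) ≤ ∏ w ∈ F, ‖w‖ := by
  set k : ℂ → ℝ := fun z => ‖B z‖ * (1 - ‖z‖ ^ 2) with hk
  have hkc : ContinuousOn k disc := by fun_prop
  have hk0 : ∀ z ∈ disc, 0 ≤ k z := fun z hz => by
    have hz' : ‖z‖ < 1 := by simpa using hz
    exact mul_nonneg (norm_nonneg _) (by nlinarith [norm_nonneg z])
  -- Removes the zero at the origin and normalizes `g 0 = 1`, so the term `log |g 0|` drops out of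
  -- Jensen's inequality.
  set g : ℂ → ℂ := fun z => dslope u 0 z / u' 0 with hg
  have hud : DifferentiableOn ℂ u disc := fun z hz =>
    (hu z hz).differentiableAt.differentiableWithinAt
  have hdisc0 : (0 : ℂ) ∈ disc := by simp
  have hgd : DifferentiableOn ℂ g disc :=
    ((Complex.differentiableOn_dslope (Metric.isOpen_ball.mem_nhds hdisc0)).2 hud).div_const _
  have hga : AnalyticOnNhd ℂ g disc := hgd.analyticOnNhd Metric.isOpen_ball
  have hg0 : g 0 = 1 := by
    rw [hg]
    simp [dslope_same, (hu 0 hdisc0).deriv, h0']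
  have hgz : ∀ z, z ≠ 0 → g z = u z / (z * u' 0) := fun z hz => by
    simp only [hg, dslope_of_ne _ hz, slope_def_field, h0, sub_zero]
    rw [div_div]
  -- Jensen's inequality on the circle of radius `r`
  have key : ∀ r : ℝ, 0 < r → r < 1 → (∀ w ∈ F, ‖w‖ ≤ r) →
      ∑ w ∈ F, Real.log (r / ‖w‖) ≤ (2 * Real.pi)⁻¹ * C := by
    intro r hr hr1 hFr
    have hsub : Metric.closedBall (0 : ℂ) r ⊆ disc := Metric.closedBall_subset_ball hr1
    have hJ := sum_log_le_circleAverage hr (hga.mono hsub) (by simp [hg0]) F fun w hw =>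
      ⟨hFr w hw, by rw [hgz w (hF w hw).2.1, (hF w hw).2.2, zero_div]⟩
    rw [hg0, norm_one, Real.log_one, add_zero] at hJ
    refine hJ.trans ?_
    rw [Real.circleAverage_def, smul_eq_mul]
    refine mul_le_mul_of_nonneg_left ?_ (by positivity)
    refine le_trans ?_ (integral_radial_integral_le hkc hk0 hC hr.le hr1)
    refine intervalIntegral.integral_mono_on Real.two_pi_pos.le ?_
      (continuous_radial_integral hkc hr.le hr1).continuousOn.intervalIntegrable fun θ _ => ?_
    · refine MeromorphicOn.circleIntegrable_log_norm fun z hz => ?_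
      rw [abs_of_pos hr] at hz
      exact (hga z (hsub (Metric.sphere_subset_closedBall hz))).meromorphicAt
    · have hz0 : circleMap 0 r θ ≠ 0 := by simpa [circleMap_zero] using hr.ne'
      have hle : ‖g (circleMap 0 r θ)‖ ≤
          Real.exp (∫ s in (0 : ℝ)..r, s * k (circleMap 0 s θ)) := by
        have hnu : 0 < ‖u' 0‖ := norm_pos_iff.2 h0'
        rw [hgz _ hz0, norm_div, norm_mul, norm_circleMap_zero, abs_of_pos hr,
          div_le_iff₀ (by positivity), mul_comm (Real.exp _)]
        exact norm_solution_le hB hu hu' h0 hr.le hr1 θ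
      have hI0 : 0 ≤ ∫ s in (0 : ℝ)..r, s * k (circleMap 0 s θ) :=
        intervalIntegral.integral_nonneg hr.le fun s hs => mul_nonneg hs.1 (hk0 _ (by
          simpa [abs_of_nonneg hs.1] using hs.2.trans_lt hr1))
      -- At a zero of `g` on the circle `Real.log 0 = 0`, so nonnegativity of the integral is
      -- needed.
      rcases eq_or_ne (g (circleMap 0 r θ)) 0 with hz | hz
      · simpa [hz] using hI0
      · exact (Real.log_le_iff_le_exp (norm_pos_iff.2 hz)).2 hle
  have hlim : Tendsto (fun r : ℝ => ∑ w ∈ F, Real.log (r / ‖w‖)) (𝓝[<] 1)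
      (𝓝 (∑ w ∈ F, Real.log (1 / ‖w‖))) := by
    refine tendsto_nhdsWithin_of_tendsto_nhds (tendsto_finsetSum _ fun w hw => ?_)
    have hw0 : ‖w‖ ≠ 0 := norm_ne_zero_iff.2 (hF w hw).2.1
    exact ((continuousAt_id.div_const _).log (by simpa using hw0)).tendsto
  have hsum : ∑ w ∈ F, Real.log (1 / ‖w‖) ≤ (2 * Real.pi)⁻¹ * C := by
    refine le_of_tendsto hlim ?_
    have hev : ∀ᶠ r : ℝ in 𝓝[<] 1, ∀ w ∈ F, ‖w‖ ≤ r := by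
      rw [Filter.eventually_all_finset]
      intro w hw
      filter_upwards [Ioo_mem_nhdsLT (hF w hw).1] with r hr using hr.1.le
    filter_upwards [hev, Ioo_mem_nhdsLT (zero_lt_one' ℝ)] with r h1 h2
    exact key r h2.1 h2.2 h1
  have hpos : ∀ w ∈ F, ‖w‖ ≠ 0 := fun w hw => norm_ne_zero_iff.2 (hF w hw).2.1
  rw [← Real.le_log_iff_exp_le (Finset.prod_pos fun w hw => norm_pos_iff.2 (hF w hw).2.1),
    Real.log_prod hpos]
  simp only [one_div, Real.log_inv, Finset.sum_neg_distrib] at hsum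
  linarith

end normalized

/-! ### The equation transplanted by an automorphism. -/

section transform

variable {A f : ℂ → ℂ} {a : ℂ}

/-- The solution `f(φ) φ'^{-1/2}` of the transformed equation, up to a constant factor. -/
noncomputable def transform (f : ℂ → ℂ) (a z : ℂ) : ℂ := f (moebius a z) * (1 + conj a * z)

/-- The derivative of `transform f a`. -/
noncomputable def transformDeriv (f : ℂ → ℂ) (a z : ℂ) : ℂ :=
  deriv f (moebius a z) * ((1 - a * conj a) / (1 + conj a * z)) + f (moebius a z) * conj a

lemma moebius_mem_disc (ha : ‖a‖ < 1) {z : ℂ} (hz : z ∈ disc) : moebius a z ∈ disc := by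
  rw [disc, mem_ball_zero_iff] at hz ⊢
  exact norm_moebius_lt_one ha hz

lemma IsSolution.hasDerivAt (hf : IsSolution A f) {z : ℂ} (hz : z ∈ disc) :
    HasDerivAt f (deriv f z) z :=
  (hf.1.differentiableAt (Metric.isOpen_ball.mem_nhds hz)).hasDerivAt

lemma IsSolution.hasDerivAt_deriv (hf : IsSolution A f) {z : ℂ} (hz : z ∈ disc) :
    HasDerivAt (deriv f) (-(A z * f z)) z := by
  have h := ((hf.1.deriv Metric.isOpen_ball).differentiableAt
    (Metric.isOpen_ball.mem_nhds hz)).hasDerivAt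
  exact h.congr_deriv (by linear_combination hf.2 z hz)

lemma hasDerivAt_one_add_conj_mul (a z : ℂ) : HasDerivAt (fun z => 1 + conj a * z) (conj a) z := by
  simpa using ((hasDerivAt_id z).const_mul (conj a)).const_add 1

lemma IsSolution.hasDerivAt_transform (hf : IsSolution A f) (ha : ‖a‖ < 1) {z : ℂ}
    (hz : z ∈ disc) : HasDerivAt (transform f a) (transformDeriv f a z) z := by
  have hz' : ‖z‖ < 1 := by simpa using hz
  have h := one_add_conj_mul_ne_zero ha hz'
  refine (((hf.hasDerivAt (moebius_mem_disc ha hz)).comp z (hasDerivAt_moebius ha hz')).mul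
    (hasDerivAt_one_add_conj_mul a z)).congr_deriv ?_
  rw [transformDeriv, moebiusDeriv]
  field_simp
  simp only [Function.comp_apply]

/-- The factor `1 + āz`, a multiple of `φ'^{-1/2}`, cancels the first-order term; no extra term
enters the coefficient since the Schwarzian of `φ` vanishes. -/
lemma IsSolution.hasDerivAt_transformDeriv (hf : IsSolution A f) (ha : ‖a‖ < 1) {z : ℂ}
    (hz : z ∈ disc) :
    HasDerivAt (transformDeriv f a) (-(pullback A a z * transform f a z)) z := by
  have hz' : ‖z‖ < 1 := by simpa using hz
  have h := one_add_conj_mul_ne_zero ha hz'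
  have hm := moebius_mem_disc ha hz
  have hφ := hasDerivAt_moebius ha hz'
  have h1 := (hf.hasDerivAt_deriv hm).comp z hφ
  have h2 : HasDerivAt (fun z => (1 - a * conj a) / (1 + conj a * z))
      (-((1 - a * conj a) * conj a) / (1 + conj a * z) ^ 2) z :=
    ((hasDerivAt_const z (1 - a * conj a)).div (hasDerivAt_one_add_conj_mul a z) h).congr_deriv
      (by ring)
  have h3 := ((hf.hasDerivAt hm).comp z hφ).mul_const (conj a)
  refine ((h1.mul h2).add h3).congr_deriv ?_
  simp only [Function.comp_apply, pullback, transform, moebiusDeriv]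
  field_simp
  ring

lemma transform_zero (f : ℂ → ℂ) (a : ℂ) : transform f a 0 = f a := by
  simp [transform, moebius_zero]

lemma continuousOn_pullback (hA : ContinuousOn A disc) (ha : ‖a‖ < 1) :
    ContinuousOn (pullback A a) disc := by
  have hne : ∀ z ∈ disc, (1 + conj a * z) ^ 2 ≠ 0 := fun z hz =>
    pow_ne_zero 2 (one_add_conj_mul_ne_zero ha (by simpa using hz))
  have h1 : ContinuousOn (moebius a) disc := fun z hz =>
    (hasDerivAt_moebius ha (by simpa using hz)).continuousAt.continuousWithinAt
  have h2 : ContinuousOn (moebiusDeriv a) disc :=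
    ContinuousOn.div continuousOn_const (by fun_prop) hne
  exact (hA.comp h1 fun z hz => moebius_mem_disc ha hz).mul (h2.pow 2)

lemma transform_moebius_neg_eq_zero (ha : ‖a‖ < 1) {w : ℂ} (hw : ‖w‖ < 1) (hfw : f w = 0) :
    transform f a (moebius (-a) w) = 0 := by
  rw [transform, moebius_moebius_neg ha hw, hfw, zero_mul]

/-- The zeros of a nontrivial solution are simple. -/
lemma IsSolution.transformDeriv_ne_zero (hA : ContinuousOn A disc) (hf : IsSolution A f)
    (hf0 : ∃ z ∈ disc, f z ≠ 0) (ha : ‖a‖ < 1) (hfa : f a = 0) : transformDeriv f a 0 ≠ 0 := by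
  intro h
  obtain ⟨z, hz, hfz⟩ := hf0
  have hz' : ‖z‖ < 1 := by simpa using hz
  have hm : ‖moebius (-a) z‖ < 1 := norm_moebius_lt_one (by simpa using ha) hz'
  have h1 := eq_zero_of_deriv_eq_zero (continuousOn_pullback hA ha)
    (fun z hz => hf.hasDerivAt_transform ha hz) (fun z hz => hf.hasDerivAt_transformDeriv ha hz)
    ((transform_zero f a).trans hfa) h (moebius (-a) z) (by simpa using hm)
  rw [transform, moebius_moebius_neg ha hz', mul_eq_zero] at h1
  exact h1.elim hfz (one_add_conj_mul_ne_zero ha hm)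

lemma IsSolution.analyticOrderAt_eq_one (hA : ContinuousOn A disc) (hf : IsSolution A f)
    (hf0 : ∃ z ∈ disc, f z ≠ 0) (ha : a ∈ disc) (hfa : f a = 0) : analyticOrderAt f a = 1 := by
  refine AnalyticAt.analyticOrderAt_eq_one_of_zero_deriv_ne_zero
    (hf.1.analyticAt (Metric.isOpen_ball.mem_nhds ha)) hfa fun h => ?_
  refine hf.transformDeriv_ne_zero hA hf0 (by simpa using ha) hfa ?_
  rw [transformDeriv, moebius_zero, h, hfa, zero_mul, zero_mul, add_zero]

/-- Identifies the factors of the separation product with moduli of zeros of the transformed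
solution. -/
lemma pseudoDist_eq_norm_moebius (z w : ℂ) : pseudoDist z w = ‖moebius (-w) z‖ := by
  have h : ‖1 - conj z * w‖ = ‖1 + conj (-w) * z‖ := by
    rw [← RCLike.norm_conj (1 - conj z * w)]
    simp only [map_sub, map_mul, map_one, Complex.conj_conj, map_neg]
    ring_nf
  rw [pseudoDist, moebius, norm_div, norm_div, h, sub_eq_neg_add]

end transform

end DiskODE

/-! ### Uniform separation of the zeros. -/

theorem mainTheorem1 (p : ℝ) (hp : 0 < p) (A : ℂ → ℂ)
    (hA : DifferentiableOn ℂ A DiskODE.disc)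
    (hcarl : DiskODE.IsCarlesonMeasure p (DiskODE.coeffMeasure A))
    (f : ℂ → ℂ) (hf : DiskODE.IsSolution A f) (hf0 : ∃ z ∈ DiskODE.disc, f z ≠ 0)
    {ι : Type*} (z : ι → ℂ) (hz : DiskODE.IsZeroSequence f z) :
    DiskODE.UniformlySeparated z := by
  have hAc := hA.continuousOn
  have hz1 : ∀ i, ‖z i‖ < 1 := fun i => by simpa using hz.1 i
  have hfz : ∀ i, f (z i) = 0 := by
    intro i
    by_contra hne
    have h := hz.2 (z i) (hz.1 i)
    rw [(hf.1.analyticAt (Metric.isOpen_ball.mem_nhds (hz.1 i))).analyticOrderAt_eq_zero.2 hne,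
      Set.encard_eq_zero] at h
    exact Set.eq_empty_iff_forall_notMem.1 h i rfl
  -- Zeros are simple, so each fibre of `z` over a zero is a singleton; the products can then be
  -- taken over finite sets of points.
  have hinj : Function.Injective z := by
    intro i j hij
    have h := hz.2 (z j) (hz.1 j)
    rw [hf.analyticOrderAt_eq_one hAc hf0 (hz.1 j) (hfz j), Set.encard_eq_one] at h
    obtain ⟨x, hx⟩ := h
    have hi : i ∈ ({x} : Set ι) := hx ▸ hij
    have hj : j ∈ ({x} : Set ι) := hx ▸ (rfl : z j = z j)
    exact hi.trans hj.symm
  obtain ⟨C, hC⟩ := hcarl.exists_lintegral_poisson_le hp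
  refine ⟨Real.exp (-((2 * Real.pi)⁻¹ * C)), Real.exp_pos _, fun k => ?_⟩
  simp only [DiskODE.pseudoDist_eq_norm_moebius]
  have hk' : ‖-z k‖ < 1 := by simpa using hz1 k
  refine DiskODE.multipliable_of_le_finset_prod (fun _ => norm_nonneg _)
    (fun n => (DiskODE.norm_moebius_lt_one hk' (hz1 n)).le) fun s => ?_
  have hinj' : Function.Injective fun n : {n : ι // n ≠ k} => DiskODE.moebius (-z k) (z n) :=
    fun m n h => Subtype.ext (hinj (DiskODE.injOn_moebius hk' (hz.1 m) (hz.1 n) h))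
  have h := DiskODE.exp_le_prod_norm_zeros (DiskODE.continuousOn_pullback hAc (hz1 k))
    (fun w hw => hf.hasDerivAt_transform (hz1 k) hw)
    (fun w hw => hf.hasDerivAt_transformDeriv (hz1 k) hw)
    ((DiskODE.transform_zero f (z k)).trans (hfz k))
    (hf.transformDeriv_ne_zero hAc hf0 (hz1 k) (hfz k))
    ((DiskODE.lintegral_pullback hAc (hz1 k)).trans_le (hC _ (hz1 k)))
    (s.map ⟨_, hinj'⟩) fun w hw => by
      obtain ⟨n, -, rfl⟩ := Finset.mem_map.1 hw
      -- Only `z k` is sent to the origin, and the index `k` is excluded.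
      refine ⟨DiskODE.norm_moebius_lt_one hk' (hz1 n), fun h0 => n.2 (hinj ?_),
        DiskODE.transform_moebius_neg_eq_zero (hz1 k) (hz1 n) (hfz n)⟩
      have := DiskODE.moebius_moebius_neg (hz1 k) (hz1 n)
      rw [← this]
      exact (congrArg _ h0).trans (DiskODE.moebius_zero _)
  simpa using h
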